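/- For complex numbers $A,q$ and an integer $n\ge 0$ write $(A;q)_n=\prod_{k=0}^{n-1}(1-Aq^k)$, and let $$f(a,b)=\sum_{j=-\infty}^{\infty}a^{j(j+1)/2}\,b^{j(j-1)/2}\quad(|ab|<1),\qquad \varphi(q)=f(q,q)\quad(|q|<1)$$ (with $0^0=1$) denote Ramanujan's theta functions. Theorem. Let $a,x\in\mathbb{C}$ with $a\neq 0$ and $|x|<1$. Then the series defining $f(a,x^2/a)$ and $\varphi(-x)=f(-x,-x)$ converge absolutely, $\varphi(-x)\neq 0$, $(x;x)_{2n+1}\ne 0$ for all $n\ge 0$, the series on the left below converges absolutely, and $$\sum_{n=0}^{\infty}\frac{x^{n(n+1)/2}\,(-x;x)_n\,(-a;x)_{n+1}\,(-x/a;x)_n}{(x;x)_{2n+1}}=\frac{f(a,x^2/a)}{\varphi(-x)}.$$ -/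

import Mathlib

/-- The finite rising `q`-factorial `(A; q)_n = (1 - A) (1 - A q) ⋯ (1 - A q ^ (n - 1))`. -/
def qPoch (A q : ℂ) (n : ℕ) : ℂ :=
  ∏ k ∈ Finset.range n, (1 - A * q ^ k)

/-- The `j`-th term `a ^ (j (j + 1) / 2) * b ^ (j (j - 1) / 2)` of Ramanujan's theta series.
Both divisions are exact and both exponents are nonnegative for every integer `j`. -/
noncomputable def thetaTerm (a b : ℂ) (j : ℤ) : ℂ :=
  a ^ (j * (j + 1) / 2) * b ^ (j * (j - 1) / 2)

/-- Ramanujan's theta function `f(a, b)`, the sum over all integers `j` of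
`a ^ (j (j + 1) / 2) * b ^ (j (j - 1) / 2)`. -/
noncomputable def ramanujanTheta (a b : ℂ) : ℂ :=
  ∑' j : ℤ, thetaTerm a b j

/-- Ramanujan's function `φ(q) = f(q, q)`. -/
noncomputable def ramanujanPhi (q : ℂ) : ℂ :=
  ramanujanTheta q q

/-! The finite Jacobi triple product expands `(-a;x)_{n+1} (-x/a;x)_n / (x;x)_{2n+1}` in powers of
`a` (`hasSum_finite_jacobi`). After interchanging sums, `a^j x^{j(j-1)/2}` has coefficient `S_j = ∑'
n, innerTerm x j n`. A telescoping certificate gives `S_{j+1} = x^j S_j` for `j > 0`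
(`tsum_innerTerm_succ`), and `S_{1-j} = S_j` handles the other indices, so `S_j = x^{j(j-1)/2} S_1`.
Hence the series equals `f(a, x^2/a) S_1`, with `S_1` independent of `a`.

At `a = -x` the factor `(1;x)_n` kills every term with `n ≥ 1`, leaving `φ(-x) S_1 = 1`. This
evaluates `S_1` and shows `φ(-x) ≠ 0` at once. -/

open Filter Topology

/-! ### Reciprocal q-factorials and uniform bounds -/

/-- `1 / (x; x)_m`, extended by zero to negative `m`. -/
noncomputable def invQFactorial (x : ℂ) (m : ℤ) : ℂ :=
  if 0 ≤ m then (qPoch x x m.toNat)⁻¹ else 0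

lemma qPoch_succ (A q : ℂ) (n : ℕ) : qPoch A q (n + 1) = qPoch A q n * (1 - A * q ^ n) := by
  simp [qPoch, Finset.prod_range_succ]

lemma one_sub_pow_succ_ne_zero {x : ℂ} (hx : ‖x‖ < 1) (n : ℕ) : 1 - x ^ (n + 1) ≠ 0 := by
  intro h
  have h1 : ‖x ^ (n + 1)‖ < 1 := by
    rw [norm_pow]
    exact pow_lt_one₀ (norm_nonneg x) hx n.succ_ne_zero
  rw [← sub_eq_zero.mp h, norm_one] at h1
  exact lt_irrefl _ h1

lemma qPoch_self_ne_zero {x : ℂ} (hx : ‖x‖ < 1) (n : ℕ) : qPoch x x n ≠ 0 := by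
  rw [qPoch, Finset.prod_ne_zero_iff]
  intro k _
  rw [← pow_succ']
  exact one_sub_pow_succ_ne_zero hx k

lemma invQFactorial_natCast (x : ℂ) (n : ℕ) :
    invQFactorial x (n : ℤ) = (qPoch x x n)⁻¹ := by
  simp [invQFactorial]

lemma invQFactorial_of_neg (x : ℂ) {m : ℤ} (hm : m < 0) : invQFactorial x m = 0 := by
  simp [invQFactorial, hm]

/-- The zero extension is consistent at `m = -1` because `1 - x ^ 0 = 0`, so later identities need
no case split on ranges. -/
lemma invQFactorial_eq_mul {x : ℂ} (hx : ‖x‖ < 1) {m m' : ℤ} (h : m + 1 = m') :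
    invQFactorial x m = (1 - x ^ m') * invQFactorial x m' := by
  subst h
  rcases lt_trichotomy m (-1) with h | rfl | h
  · rw [invQFactorial_of_neg x (by omega), invQFactorial_of_neg x (by omega), mul_zero]
  · rw [invQFactorial_of_neg x (by omega)]
    simp
  · obtain ⟨n, rfl⟩ := Int.eq_ofNat_of_zero_le (show 0 ≤ m by omega)
    have h2 : ((n : ℤ) + 1) = ((n + 1 : ℕ) : ℤ) := by push_cast; rfl
    rw [h2, invQFactorial_natCast, invQFactorial_natCast, qPoch_succ, zpow_natCast, ← pow_succ',
      mul_inv, mul_comm, mul_assoc, inv_mul_cancel₀ (one_sub_pow_succ_ne_zero hx n), mul_one]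

lemma norm_prod_one_add_le {f : ℕ → ℂ} {S : ℝ} {n : ℕ}
    (h : ∑ k ∈ Finset.range n, ‖f k‖ ≤ S) :
    ‖∏ k ∈ Finset.range n, (1 + f k)‖ ≤ Real.exp S := by
  rw [norm_prod]
  calc ∏ k ∈ Finset.range n, ‖1 + f k‖
      ≤ ∏ k ∈ Finset.range n, Real.exp ‖f k‖ := by
        refine Finset.prod_le_prod (fun _ _ => norm_nonneg _) fun k _ => ?_
        have h1 := norm_add_le 1 (f k)
        rw [norm_one] at h1
        linarith [Real.add_one_le_exp ‖f k‖]
    _ = Real.exp (∑ k ∈ Finset.range n, ‖f k‖) := (Real.exp_sum _ _).symm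
    _ ≤ Real.exp S := Real.exp_le_exp.mpr h

lemma sum_mul_pow_le {r c : ℝ} (hr : 0 ≤ r) (hr1 : r < 1) (hc : 0 ≤ c) (n : ℕ) :
    ∑ k ∈ Finset.range n, c * r ^ k ≤ c * (1 - r)⁻¹ := by
  rw [← Finset.mul_sum, ← tsum_geometric_of_lt_one hr hr1]
  exact mul_le_mul_of_nonneg_left
    ((summable_geometric_of_lt_one hr hr1).sum_le_tsum _ fun _ _ => by positivity) hc

lemma exists_norm_qPoch_le (A : ℂ) {x : ℂ} (hx : ‖x‖ < 1) : ∃ K, ∀ n, ‖qPoch A x n‖ ≤ K := by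
  refine ⟨Real.exp (‖A‖ * (1 - ‖x‖)⁻¹), fun n => ?_⟩
  simp only [qPoch, sub_eq_add_neg (1 : ℂ)]
  refine norm_prod_one_add_le ?_
  simp only [norm_neg, norm_mul, norm_pow]
  exact sum_mul_pow_le (norm_nonneg x) hx (norm_nonneg A) n

lemma exists_norm_invQFactorial_le {x : ℂ} (hx : ‖x‖ < 1) :
    ∃ K, ∀ m, ‖invQFactorial x m‖ ≤ K := by
  refine ⟨Real.exp ((1 - ‖x‖)⁻¹ * (1 - ‖x‖)⁻¹), fun m => ?_⟩
  have hpos : 0 < 1 - ‖x‖ := by linarith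
  rcases lt_or_ge m 0 with h | h
  · rw [invQFactorial_of_neg x h, norm_zero]
    positivity
  · obtain ⟨n, rfl⟩ := Int.eq_ofNat_of_zero_le h
    -- Each inverse factor is `1 + u_k` with `‖u_k‖ ≤ ‖x‖ ^ k / (1 - ‖x‖)`, so the product bound
    -- applies.
    have key : ∀ k : ℕ, (1 - x * x ^ k)⁻¹ = 1 + x ^ (k + 1) / (1 - x ^ (k + 1)) := by
      intro k
      have := one_sub_pow_succ_ne_zero hx k
      rw [← pow_succ']
      field_simp
      ring
    rw [invQFactorial_natCast, qPoch, ← Finset.prod_inv_distrib, Finset.prod_congr rfl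
      fun k _ => key k]
    refine norm_prod_one_add_le ((Finset.sum_le_sum fun k _ => ?_).trans
      (sum_mul_pow_le (norm_nonneg x) hx (inv_nonneg.mpr hpos.le) n))
    have h1 : ‖x‖ ^ (k + 1) ≤ ‖x‖ ^ k :=
      pow_le_pow_of_le_one (norm_nonneg x) hx.le (Nat.le_succ k)
    have h2 : 1 - ‖x‖ ≤ ‖1 - x ^ (k + 1)‖ := by
      have h3 := norm_sub_norm_le 1 (x ^ (k + 1))
      have h4 : ‖x‖ ^ (k + 1) ≤ ‖x‖ :=
        pow_le_of_le_one (norm_nonneg x) hx.le k.succ_ne_zero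
      rw [norm_one, norm_pow] at h3
      linarith
    rw [norm_div, norm_pow, div_eq_inv_mul]
    gcongr

/-! ### Triangular exponents and convergence -/

lemma triangle_succ (j : ℤ) : (j + 1) * (j + 1 - 1) / 2 = j * (j - 1) / 2 + j := by
  have : (j + 1) * (j + 1 - 1) = j * (j - 1) + j * 2 := by ring
  rw [this, Int.add_mul_ediv_right _ _ (by norm_num)]

lemma triangle_symm (j : ℤ) : (1 - j) * (1 - j - 1) / 2 = j * (j - 1) / 2 := by
  congr 1
  ring

lemma nat_triangle_succ (n : ℕ) : (n + 1) * (n + 1 + 1) / 2 = n * (n + 1) / 2 + (n + 1) := by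
  have : (n + 1) * (n + 1 + 1) = n * (n + 1) + (n + 1) * 2 := by ring
  rw [this, Nat.add_mul_div_right _ _ (by norm_num)]

lemma summable_mul_pow_triangle {r : ℝ} (hr : 0 ≤ r) (hr1 : r < 1) (R : ℝ) :
    Summable fun n : ℕ => R ^ n * r ^ (n * (n + 1) / 2) := by
  have h : Tendsto (fun n : ℕ => ‖R‖ * r ^ (n + 1)) atTop (𝓝 0) := by
    simpa using ((tendsto_pow_atTop_nhds_zero_of_lt_one hr hr1).comp
      (tendsto_add_atTop_nat 1)).const_mul ‖R‖
  refine summable_of_ratio_norm_eventually_le (r := 1 / 2) (by norm_num) ?_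
  filter_upwards [h.eventually_le_const (show (0 : ℝ) < 1 / 2 by norm_num)] with n hn
  have h1 : R ^ (n + 1) * r ^ ((n + 1) * (n + 1 + 1) / 2) =
      R * r ^ (n + 1) * (R ^ n * r ^ (n * (n + 1) / 2)) := by
    rw [nat_triangle_succ, pow_succ, pow_add]
    ring
  rw [h1, norm_mul]
  refine mul_le_mul_of_nonneg_right ?_ (norm_nonneg _)
  rwa [norm_mul, norm_pow, Real.norm_of_nonneg hr]

lemma triangle_natCast_add_one (n : ℕ) :
    ((n : ℤ) + 1) * ((n : ℤ) + 1 - 1) / 2 = ((n * (n + 1) / 2 : ℕ) : ℤ) := by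
  push_cast
  congr 1
  ring

lemma triangle_neg_natCast (n : ℕ) :
    (-(n : ℤ)) * (-(n : ℤ) - 1) / 2 = ((n * (n + 1) / 2 : ℕ) : ℤ) := by
  push_cast
  congr 1
  ring

lemma summable_zpow_mul_zpow_triangle {r : ℝ} (hr : 0 ≤ r) (hr1 : r < 1) {R : ℝ} (hR : R ≠ 0) :
    Summable fun j : ℤ => R ^ j * r ^ (j * (j - 1) / 2) := by
  refine Summable.of_nat_of_neg ?_ ?_
  · rw [← summable_nat_add_iff 1]
    refine ((summable_mul_pow_triangle hr hr1 R).mul_left R).congr fun n => ?_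
    push_cast
    rw [triangle_natCast_add_one, zpow_natCast, zpow_add_one₀ hR, zpow_natCast]
    ring
  · refine (summable_mul_pow_triangle hr hr1 R⁻¹).congr fun n => ?_
    rw [triangle_neg_natCast, zpow_natCast, zpow_neg, zpow_natCast, inv_pow]

/-! ### Finite Jacobi triple product -/

/-- The finite form of the Jacobi triple product identity. -/
lemma hasSum_finite_jacobi {a x : ℂ} (ha : a ≠ 0) (hx0 : x ≠ 0) (hx : ‖x‖ < 1) (k l : ℕ) :
    HasSum (fun j : ℤ => a ^ j * x ^ (j * (j - 1) / 2) *
        (invQFactorial x (l + j) * invQFactorial x (k - j)))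
      (qPoch (-a) x k * qPoch (-x / a) x l / qPoch x x (k + l)) := by
  induction k with
  | zero =>
    induction l with
    | zero =>
      have h : ∀ j : ℤ, j ≠ 0 → a ^ j * x ^ (j * (j - 1) / 2) *
          (invQFactorial x ((0 : ℕ) + j) * invQFactorial x ((0 : ℕ) - j)) = 0 := by
        intro j hj
        rcases lt_or_gt_of_ne hj with h | h
        · rw [invQFactorial_of_neg x (m := (0 : ℕ) + j) (by simpa using h)]
          ring
        · rw [invQFactorial_of_neg x (m := (0 : ℕ) - j) (by simpa using h)]
          ring
      convert hasSum_single (0 : ℤ) h using 1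
      simp [qPoch, invQFactorial]
    | succ l ih =>
      -- The new factor is `1 + x ^ (l + 1) / a`; its second term is absorbed by the shift `j ↦ j +
      -- 1`.
      have h1 := ((ih.add ((Equiv.addRight (1 : ℤ)).hasSum_iff.mpr
        ih |>.mul_left (x ^ (l + 1) / a))).mul_left (1 - x ^ (l + 1))⁻¹)
      have hne := one_sub_pow_succ_ne_zero hx l
      convert h1 using 1
      · rfl
      · funext j
        rw [eq_inv_mul_iff_mul_eq₀ hne]
        simp only [Function.comp_apply, Equiv.coe_addRight]
        rw [invQFactorial_eq_mul hx (m := (l : ℤ) + j) (m' := ((l + 1 : ℕ) : ℤ) + j)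
            (by push_cast; ring),
          invQFactorial_eq_mul hx (m := ((0 : ℕ) : ℤ) - (j + 1)) (m' := ((0 : ℕ) : ℤ) - j) (by ring),
          show (l : ℤ) + (j + 1) = ((l + 1 : ℕ) : ℤ) + j by push_cast; ring, triangle_succ,
          zpow_add₀ hx0, zpow_add₀ hx0 _ j, zpow_sub₀ hx0, zpow_add_one₀ ha, zpow_natCast,
          zpow_natCast]
        have := zpow_ne_zero j hx0
        field_simp
        ring
      · rw [eq_inv_mul_iff_mul_eq₀ hne]
        have := qPoch_self_ne_zero hx l
        rw [Nat.zero_add, Nat.zero_add, qPoch_succ x, qPoch_succ (-x / a), ← pow_succ']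
        field_simp
        ring
  | succ k ih =>
    -- Likewise for the factor `1 + a * x ^ k`, with the shift `j ↦ j - 1`.
    have h1 := ((ih.add ((Equiv.subRight (1 : ℤ)).hasSum_iff.mpr
      ih |>.mul_left (x ^ k * a))).mul_left (1 - x ^ (k + l + 1))⁻¹)
    have hne := one_sub_pow_succ_ne_zero hx (k + l)
    convert h1 using 1
    · rfl
    · funext j
      rw [eq_inv_mul_iff_mul_eq₀ hne]
      simp only [Function.comp_apply, Equiv.subRight_apply]
      have ht := triangle_succ (j - 1)
      rw [sub_add_cancel] at ht
      rw [invQFactorial_eq_mul hx (m := (k : ℤ) - j) (m' := ((k + 1 : ℕ) : ℤ) - j)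
          (by push_cast; ring),
        invQFactorial_eq_mul hx (m := (l : ℤ) + (j - 1)) (m' := (l : ℤ) + j) (by ring),
        show (k : ℤ) - (j - 1) = ((k + 1 : ℕ) : ℤ) - j by push_cast; ring, ht,
        zpow_add₀ hx0 _ (j - 1), zpow_sub_one₀ hx0, zpow_add₀ hx0 _ j, zpow_sub₀ hx0,
        zpow_sub_one₀ ha, zpow_natCast, zpow_natCast]
      have := zpow_ne_zero j hx0
      field_simp
      ring
    · rw [eq_inv_mul_iff_mul_eq₀ hne]
      have := qPoch_self_ne_zero hx (k + l)
      rw [show k + 1 + l = k + l + 1 by ring, qPoch_succ x, qPoch_succ (-a), ← pow_succ']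
      field_simp
      ring

/-! ### Summation over `n` and the recurrence in `j` -/

lemma summable_pow_triangle {r : ℝ} (hr : 0 ≤ r) (hr1 : r < 1) :
    Summable fun n : ℕ => r ^ (n * (n + 1) / 2) := by
  simpa using summable_mul_pow_triangle hr hr1 1

/-- The coefficient of `a ^ j * x ^ (j * (j - 1) / 2)` in the `n`-th summand of the series. -/
noncomputable def innerTerm (x : ℂ) (j : ℤ) (n : ℕ) : ℂ :=
  x ^ (n * (n + 1) / 2) * qPoch (-x) x n *
    (invQFactorial x (n + j) * invQFactorial x (n + 1 - j))

lemma exists_norm_innerTerm_le {x : ℂ} (hx : ‖x‖ < 1) :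
    ∃ K, ∀ j n, ‖innerTerm x j n‖ ≤ K * ‖x‖ ^ (n * (n + 1) / 2) := by
  obtain ⟨A, hA⟩ := exists_norm_qPoch_le (-x) hx
  obtain ⟨B, hB⟩ := exists_norm_invQFactorial_le hx
  have hA0 : 0 ≤ A := (norm_nonneg _).trans (hA 0)
  have hB0 : 0 ≤ B := (norm_nonneg _).trans (hB 0)
  refine ⟨A * (B * B), fun j n => ?_⟩
  rw [innerTerm, norm_mul, norm_mul, norm_mul, norm_pow]
  calc ‖x‖ ^ (n * (n + 1) / 2) * ‖qPoch (-x) x n‖ *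
        (‖invQFactorial x (n + j)‖ * ‖invQFactorial x (n + 1 - j)‖)
      ≤ ‖x‖ ^ (n * (n + 1) / 2) * A * (B * B) := by
        gcongr
        exacts [hA n, hB _, hB _]
    _ = A * (B * B) * ‖x‖ ^ (n * (n + 1) / 2) := by ring

lemma summable_innerTerm {x : ℂ} (hx : ‖x‖ < 1) (j : ℤ) : Summable (innerTerm x j) := by
  obtain ⟨K, hK⟩ := exists_norm_innerTerm_le hx
  exact Summable.of_norm_bounded
    ((summable_pow_triangle (norm_nonneg x) hx).mul_left K) (hK j)

lemma innerTerm_one_sub (x : ℂ) (j : ℤ) : innerTerm x (1 - j) = innerTerm x j := by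
  funext n
  rw [innerTerm, innerTerm, show (n : ℤ) + (1 - j) = n + 1 - j by ring,
    show (n : ℤ) + 1 - (1 - j) = n + j by ring, mul_comm (invQFactorial x (n + 1 - j))]

/-- The antidifference certifying the recurrence for `∑' n, innerTerm x j n` in `j`. -/
noncomputable def innerCertificate (x : ℂ) (j : ℤ) (n : ℕ) : ℂ :=
  -(x ^ (n * (n + 1) / 2) * qPoch (-x) x n *
    (invQFactorial x (n + j + 1) * invQFactorial x (n - j)) * (1 + x ^ (n + 1) * (1 - x ^ j)))

/-- With `n` shifted in the second term, all four terms are multiples of `1 / ((x;x)_{n+j+2}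
(x;x)_{n+1-j})`, which leaves an elementary identity in powers of `x`. -/
lemma innerCertificate_sub {x : ℂ} (hx0 : x ≠ 0) (hx : ‖x‖ < 1) (j : ℤ) (n : ℕ) :
    innerTerm x j n - (x ^ j)⁻¹ * innerTerm x (j + 1) (n + 1) =
      innerCertificate x j (n + 1) - innerCertificate x j n := by
  have hj := zpow_ne_zero j hx0
  rw [innerTerm, innerTerm, innerCertificate, innerCertificate, nat_triangle_succ, qPoch_succ,
    invQFactorial_eq_mul hx (m := n + j) (m' := n + j + 1) rfl,
    show ((n + 1 : ℕ) : ℤ) + (j + 1) = n + j + 1 + 1 by push_cast; ring,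
    show ((n + 1 : ℕ) : ℤ) + 1 - (j + 1) = n + 1 - j by push_cast; ring,
    show ((n + 1 : ℕ) : ℤ) + j + 1 = n + j + 1 + 1 by push_cast; ring,
    show ((n + 1 : ℕ) : ℤ) - j = n + 1 - j by push_cast; ring,
    invQFactorial_eq_mul hx (m := n + j + 1) (m' := n + j + 1 + 1) rfl,
    invQFactorial_eq_mul hx (m := n - j) (m' := n + 1 - j) (by ring),
    zpow_sub₀ hx0, zpow_add_one₀ hx0 (n + j + 1), zpow_add_one₀ hx0 (n + j), zpow_add₀ hx0 n j,
    zpow_add_one₀ hx0, zpow_natCast, pow_add]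
  field_simp
  ring

lemma tendsto_innerCertificate {x : ℂ} (hx : ‖x‖ < 1) (j : ℤ) :
    Tendsto (innerCertificate x j) atTop (𝓝 0) := by
  obtain ⟨A, hA⟩ := exists_norm_qPoch_le (-x) hx
  obtain ⟨B, hB⟩ := exists_norm_invQFactorial_le hx
  have hA0 : 0 ≤ A := (norm_nonneg _).trans (hA 0)
  have hB0 : 0 ≤ B := (norm_nonneg _).trans (hB 0)
  have hlim := (summable_pow_triangle (norm_nonneg x) hx).tendsto_atTop_zero.mul_const
    (A * (B * B) * (1 + ‖1 - x ^ j‖))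
  rw [zero_mul] at hlim
  refine squeeze_zero_norm (fun n => ?_) hlim
  rw [innerCertificate, norm_neg, norm_mul, norm_mul, norm_mul, norm_mul, norm_pow]
  have h1 : ‖1 + x ^ (n + 1) * (1 - x ^ j)‖ ≤ 1 + ‖1 - x ^ j‖ := by
    refine (norm_add_le _ _).trans ?_
    rw [norm_one, norm_mul, norm_pow]
    have := mul_le_mul_of_nonneg_right (pow_le_one₀ (n := n + 1) (norm_nonneg x) hx.le)
      (norm_nonneg (1 - x ^ j))
    linarith
  rw [mul_assoc (A : ℝ), ← mul_assoc _ A, ← mul_assoc (_ * A)]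
  gcongr
  exacts [hA n, hB _, hB _]

/-- For `j > 0` the factor `invQFactorial x (-j)` annihilates both boundary contributions at `n =
0`. -/
lemma tsum_innerTerm_succ {x : ℂ} (hx0 : x ≠ 0) (hx : ‖x‖ < 1) {j : ℤ} (hj : 0 < j) :
    ∑' n, innerTerm x (j + 1) n = x ^ j * ∑' n, innerTerm x j n := by
  have hz : innerTerm x (j + 1) 0 = 0 := by
    rw [innerTerm, invQFactorial_of_neg x (m := ((0 : ℕ) : ℤ) + 1 - (j + 1)) (by simpa using hj)]
    ring
  have hshift := (summable_innerTerm hx (j + 1)).tsum_eq_zero_add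
  rw [hz, zero_add] at hshift
  have h := ((summable_innerTerm hx j).hasSum.sub
    (((summable_nat_add_iff 1).mpr (summable_innerTerm hx (j + 1))).hasSum.mul_left
      (x ^ j)⁻¹)).tendsto_sum_nat
  have h0 : innerCertificate x j 0 = 0 := by
    rw [innerCertificate, invQFactorial_of_neg x (m := ((0 : ℕ) : ℤ) - j) (by simpa using hj)]
    ring
  have h2 : Tendsto (fun N => ∑ n ∈ Finset.range N,
      (innerTerm x j n - (x ^ j)⁻¹ * innerTerm x (j + 1) (n + 1))) atTop (𝓝 0) := by
    refine (tendsto_innerCertificate hx j).congr fun N => ?_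
    rw [Finset.sum_congr rfl fun n _ => innerCertificate_sub hx0 hx j n, Finset.sum_range_sub, h0,
      sub_zero]
  have h3 := tendsto_nhds_unique h h2
  rw [sub_eq_zero] at h3
  rw [h3, hshift, mul_inv_cancel_left₀ (zpow_ne_zero j hx0)]

lemma tsum_innerTerm {x : ℂ} (hx0 : x ≠ 0) (hx : ‖x‖ < 1) (j : ℤ) :
    ∑' n, innerTerm x j n = x ^ (j * (j - 1) / 2) * ∑' n, innerTerm x 1 n := by
  have pos : ∀ k : ℕ, ∑' n, innerTerm x (k + 1) n =
      x ^ (((k : ℤ) + 1) * ((k : ℤ) + 1 - 1) / 2) * ∑' n, innerTerm x 1 n := by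
    intro k
    induction k with
    | zero => simp
    | succ k ih =>
      rw [triangle_succ, zpow_add₀ hx0, tsum_innerTerm_succ hx0 hx (by omega)]
      push_cast
      rw [ih]
      ring
  rcases lt_or_ge 0 j with h | h
  · obtain ⟨k, hk⟩ := Int.eq_ofNat_of_zero_le (show 0 ≤ j - 1 by omega)
    obtain rfl : j = k + 1 := by omega
    exact pos k
  · obtain ⟨k, hk⟩ := Int.eq_ofNat_of_zero_le (show 0 ≤ -j by omega)
    rw [← innerTerm_one_sub, ← triangle_symm j, show 1 - j = (k : ℤ) + 1 by omega]
    exact pos k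

/-! ### Interchange of the two summations -/

lemma thetaTerm_eq {a x : ℂ} (ha : a ≠ 0) (hx0 : x ≠ 0) (j : ℤ) :
    thetaTerm a (x ^ 2 / a) j = a ^ j * x ^ (j * (j - 1) / 2) * x ^ (j * (j - 1) / 2) := by
  have h := triangle_succ j
  rw [show (j + 1) * (j + 1 - 1) = j * (j + 1) by ring] at h
  have := zpow_ne_zero (j * (j - 1) / 2) ha
  rw [thetaTerm, h, zpow_add₀ ha, div_zpow, ← zpow_natCast x 2, ← zpow_mul, mul_comm ((2 : ℕ) : ℤ),
    zpow_mul, zpow_natCast]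
  field_simp

lemma summable_norm_zpow_triangle {a x : ℂ} (ha : a ≠ 0) (hx : ‖x‖ < 1) :
    Summable fun j : ℤ => ‖a ^ j * x ^ (j * (j - 1) / 2)‖ := by
  refine (summable_zpow_mul_zpow_triangle (norm_nonneg x) hx (norm_ne_zero_iff.mpr ha)).congr
    fun j => ?_
  rw [norm_mul, norm_zpow, norm_zpow]

/-- The series is a constant multiple of the theta function, the factor not depending on `a`. -/
lemma hasSum_series {a x : ℂ} (ha : a ≠ 0) (hx0 : x ≠ 0) (hx : ‖x‖ < 1) :
    Summable (thetaTerm a (x ^ 2 / a)) ∧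
    HasSum
      (fun n : ℕ =>
        x ^ (n * (n + 1) / 2) * qPoch (-x) x n * qPoch (-a) x (n + 1) * qPoch (-x / a) x n /
          qPoch x x (2 * n + 1))
      (ramanujanTheta a (x ^ 2 / a) * ∑' n, innerTerm x 1 n) := by
  set F : ℕ × ℤ → ℂ := fun p => a ^ p.2 * x ^ (p.2 * (p.2 - 1) / 2) * innerTerm x p.2 p.1 with hF
  -- The bound on `innerTerm` is uniform in `j`, so a product of a series in `n` and a series in `j`
  -- dominates.
  have hs : Summable F := by
    obtain ⟨K, hK⟩ := exists_norm_innerTerm_le hx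
    have hb := ((summable_pow_triangle (norm_nonneg x) hx).mul_of_nonneg
      (summable_norm_zpow_triangle ha hx) (fun _ => by positivity)
      (fun _ => norm_nonneg _)).mul_left K
    refine Summable.of_norm_bounded hb fun p => ?_
    rw [hF, norm_mul]
    calc _ ≤ _ := mul_le_mul_of_nonneg_left (hK p.2 p.1) (norm_nonneg _)
      _ = _ := by ring
  have hrow : ∀ n : ℕ, HasSum (fun j : ℤ => F (n, j))
      (x ^ (n * (n + 1) / 2) * qPoch (-x) x n * qPoch (-a) x (n + 1) * qPoch (-x / a) x n /
          qPoch x x (2 * n + 1)) := by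
    intro n
    have h := (hasSum_finite_jacobi ha hx0 hx (n + 1) n).mul_left
      (x ^ (n * (n + 1) / 2) * qPoch (-x) x n)
    rw [show n + 1 + n = 2 * n + 1 by ring] at h
    have e1 : ∀ j : ℤ, F (n, j) = x ^ (n * (n + 1) / 2) * qPoch (-x) x n *
        (a ^ j * x ^ (j * (j - 1) / 2) *
          (invQFactorial x (n + j) * invQFactorial x (((n + 1 : ℕ) : ℤ) - j))) := by
      intro j
      simp only [hF, innerTerm]
      push_cast
      ring
    simp only [e1]
    rw [mul_assoc, mul_div_assoc]
    exact h
  have hcol : ∀ j : ℤ, HasSum (fun n : ℕ => F (n, j))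
      (thetaTerm a (x ^ 2 / a) j * ∑' n, innerTerm x 1 n) := by
    intro j
    have h := (summable_innerTerm hx j).hasSum.mul_left (a ^ j * x ^ (j * (j - 1) / 2))
    rw [tsum_innerTerm hx0 hx, ← mul_assoc, ← thetaTerm_eq ha hx0] at h
    exact h
  have hθ : Summable (thetaTerm a (x ^ 2 / a)) := by
    refine Summable.of_norm_bounded (summable_norm_zpow_triangle ha hx) fun j => ?_
    obtain ⟨m, hm⟩ : ∃ m : ℕ, j * (j - 1) / 2 = m := by
      refine Int.eq_ofNat_of_zero_le (Int.ediv_nonneg ?_ (by norm_num))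
      rcases lt_or_ge 0 j with h | h <;> nlinarith
    rw [thetaTerm_eq ha hx0, norm_mul]
    refine mul_le_of_le_one_right (norm_nonneg _) ?_
    rw [hm, zpow_natCast, norm_pow]
    exact pow_le_one₀ (norm_nonneg x) hx.le
  refine ⟨hθ, ?_⟩
  have h1 := hs.hasSum.prod_fiberwise hrow
  have h2 := ((Equiv.prodComm ℤ ℕ).hasSum_iff.mpr hs.hasSum).prod_fiberwise hcol
  have h3 := h2.unique (hθ.hasSum.mul_right _)
  rw [h3] at h1
  exact h1

/-! ### The case `x = 0` and the conclusion -/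

lemma thetaTerm_zero_right_of_ne (a : ℂ) {j : ℤ} (h0 : j ≠ 0) (h1 : j ≠ 1) :
    thetaTerm a 0 j = 0 := by
  have : 0 < j * (j - 1) / 2 := by
    have : 2 ≤ j * (j - 1) := by
      rcases lt_or_ge 0 j with h | h
      · have : 2 ≤ j := by omega
        nlinarith
      · have : j ≤ -1 := by omega
        nlinarith
    omega
  rw [thetaTerm, zero_zpow _ this.ne', mul_zero]

lemma hasSum_thetaTerm_zero_right (a : ℂ) : HasSum (thetaTerm a 0) (1 + a) := by
  have h := hasSum_sum_of_ne_finset_zero (L := .unconditional ℤ) (f := thetaTerm a 0) (s := {0, 1}) fun j hj => by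
    simp only [Finset.mem_insert, Finset.mem_singleton, not_or] at hj
    exact thetaTerm_zero_right_of_ne a hj.1 hj.2
  simpa [thetaTerm] using h

lemma hasSum_series_zero (a : ℂ) :
    HasSum
      (fun n : ℕ =>
        (0 : ℂ) ^ (n * (n + 1) / 2) * qPoch (-0) 0 n * qPoch (-a) 0 (n + 1) * qPoch (-0 / a) 0 n /
          qPoch 0 0 (2 * n + 1))
      (1 + a) := by
  have h := hasSum_single (f := fun n : ℕ =>
    (0 : ℂ) ^ (n * (n + 1) / 2) * qPoch (-0) 0 n * qPoch (-a) 0 (n + 1) * qPoch (-0 / a) 0 n /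
      qPoch 0 0 (2 * n + 1)) 0 fun n hn => by
    obtain ⟨m, rfl⟩ := Nat.exists_eq_succ_of_ne_zero hn
    rw [Nat.succ_eq_add_one, nat_triangle_succ, pow_add, pow_succ]
    simp
  simpa [qPoch] using h

/-- In `ℂ`, unconditional summability is absolute convergence. -/
theorem mainTheorem3 (a x : ℂ) (ha : a ≠ 0) (hx : ‖x‖ < 1) :
    Summable (thetaTerm a (x ^ 2 / a)) ∧
    Summable (thetaTerm (-x) (-x)) ∧
    ramanujanPhi (-x) ≠ 0 ∧
    (∀ n : ℕ, qPoch x x (2 * n + 1) ≠ 0) ∧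
    HasSum
      (fun n : ℕ =>
        x ^ (n * (n + 1) / 2) * qPoch (-x) x n * qPoch (-a) x (n + 1) * qPoch (-x / a) x n /
          qPoch x x (2 * n + 1))
      (ramanujanTheta a (x ^ 2 / a) / ramanujanPhi (-x)) := by
  -- The recurrences divide by powers of `x`; at `x = 0` only `j = 0, 1` survive in the theta
  -- series.
  rcases eq_or_ne x 0 with rfl | hx0
  · have hφ : ramanujanPhi (-0) = 1 := by
      rw [ramanujanPhi, ramanujanTheta, neg_zero, (hasSum_thetaTerm_zero_right 0).tsum_eq, add_zero]
    have hz : (0 : ℂ) ^ 2 / a = 0 := by simp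
    refine ⟨?_, ?_, ?_, fun n => qPoch_self_ne_zero hx _, ?_⟩
    · rw [hz]
      exact (hasSum_thetaTerm_zero_right a).summable
    · rw [neg_zero]
      exact (hasSum_thetaTerm_zero_right 0).summable
    · rw [hφ]
      exact one_ne_zero
    · rw [hφ, div_one, hz, ramanujanTheta, (hasSum_thetaTerm_zero_right a).tsum_eq]
      exact hasSum_series_zero a
  · obtain ⟨hθ, hsum⟩ := hasSum_series ha hx0 hx
    obtain ⟨hφs, hφsum⟩ := hasSum_series (neg_ne_zero.mpr hx0) hx0 hx
    have hsq : x ^ 2 / -x = -x := by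
      field_simp
    rw [hsq] at hφs hφsum
    have hone := hasSum_single (f := fun n : ℕ =>
        x ^ (n * (n + 1) / 2) * qPoch (-x) x n * qPoch (-(-x)) x (n + 1) * qPoch (-x / -x) x n /
          qPoch x x (2 * n + 1)) 0 fun n hn => by
      obtain ⟨m, rfl⟩ := Nat.exists_eq_succ_of_ne_zero hn
      have : qPoch (-x / -x) x (m + 1) = 0 := by
        rw [div_self (neg_ne_zero.mpr hx0), qPoch, Finset.prod_range_succ']
        simp
      simp only [Nat.succ_eq_add_one]
      rw [this, mul_zero, zero_div]
    have hconst := hφsum.unique hone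
    have h1 := one_sub_pow_succ_ne_zero hx 0
    have hval : ramanujanPhi (-x) * ∑' n, innerTerm x 1 n = 1 := by
      rw [ramanujanPhi, hconst]
      simp only [zero_add, pow_one] at h1
      simp [qPoch, h1]
    refine ⟨hθ, hφs, left_ne_zero_of_mul_eq_one hval, fun n => qPoch_self_ne_zero hx _, ?_⟩
    rw [div_eq_mul_inv (ramanujanTheta _ _), inv_eq_of_mul_eq_one_right hval]
    exact hsum
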